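/- An $r$-graph $H$ has a finite vertex set $V(H)$ and edge set $E(H)\subseteq\binom{V(H)}{r}$. For $p\ge 1$ its $p$-spectral radius is $$\lambda^{(p)}(H)=\max\Big\{\, r!\sum_{e\in E(H)}\prod_{v\in e}x_v \;:\; x\in\mathbb{R}^{V(H)},\ \Big(\sum_{v}|x_v|^p\Big)^{1/p}=1\Big\}.$$ Let $H_t^{(r)}$ be the $r$-graph obtained from the complete graph $K_t$ by enlarging each edge with its own set of $r-2$ new vertices (these sets being pairwise disjoint and disjoint from $V(K_t)$). An $r$-graph is $H_t^{(r)}$-free if it contains no copy of $H_t^{(r)}$ as a (not necessarily induced) subgraph. Let $T_r(n,k)$ be the complete $k$-partite $r$-graph on $n$ vertices (its edges are all $r$-sets meeting each part in at most one vertex) whose part sizes pairwise differ by at most one, and let $(k)_r=k(k-1)\cdots(k-r+1)$. **Theorem.** Let $p>1$ be real and let $k\ge r\ge 3$ be integers. For every $\varepsilon>0$ there are $\delta>0$ and $n_0$ (depending only on $p,k,r,\varepsilon$) such that the following holds for all $n>n_0$: if $H$ is an $n$-vertex $H_{k+1}^{(r)}$-free $r$-graph with $$\lambda^{(p)}(H)>(1-\delta)\,\frac{(k)_r}{k^r}\,n^{r(1-1/p)},$$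 then $H$ can be transformed into a copy of $T_r(n,k)$ on the same vertex set by adding and deleting at most $\varepsilon\binom{n}{r}$ edges in total. -/

import Mathlib

/-- An `r`-graph (an `r`-uniform hypergraph) with vertex set `V`: its edges are
`r`-element subsets of `V`. -/
structure RGraph (r : ℕ) (V : Type*) where
  /-- The edges. -/
  edges : Finset (Finset V)
  /-- Every edge has exactly `r` vertices. -/
  sized : (edges : Set (Finset V)).Sized r

namespace RGraph

/-- `H` contains `F` as a (not necessarily induced) subgraph: there is an injection of the
vertices of `F` into those of `H` that maps edges to edges. -/
def Contains {r : ℕ} {V W : Type*} (H : RGraph r V) (F : RGraph r W) : Prop :=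
  ∃ f : W ↪ V, ∀ e ∈ F.edges, e.map f ∈ H.edges

/-- `H` is `F`-free. -/
def Free {r : ℕ} {V W : Type*} (H : RGraph r V) (F : RGraph r W) : Prop :=
  ¬ H.Contains F

/-- The polynomial form `P_H(x) = r! ∑_{e ∈ E(H)} ∏_{v ∈ e} x_v`. -/
def form {r : ℕ} {V : Type*} (H : RGraph r V) (x : V → ℝ) : ℝ :=
  (r.factorial : ℝ) * ∑ e ∈ H.edges, ∏ v ∈ e, x v

end RGraph

/-- The `ℓ^p` norm `(∑ |x_v|^p)^(1/p)`. -/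
noncomputable def pNorm {V : Type*} [Fintype V] (p : ℝ) (x : V → ℝ) : ℝ :=
  (∑ v, |x v| ^ p) ^ (1 / p)

namespace RGraph

/-- The `p`-spectral radius, the maximum of `P_H(x)` over all real `x` with `‖x‖_p = 1`.
That the maximum is attained is `RGraph.isGreatest_spectralRadius`. -/
noncomputable def spectralRadius {r : ℕ} {V : Type*} [Fintype V] (p : ℝ) (H : RGraph r V) : ℝ :=
  sSup {y : ℝ | ∃ x : V → ℝ, pNorm p x = 1 ∧ y = H.form x}

theorem isGreatest_spectralRadius {r : ℕ} {V : Type*} [Fintype V] [Nonempty V] {p : ℝ}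
    (hp : 1 ≤ p) (H : RGraph r V) :
    IsGreatest {y : ℝ | ∃ x : V → ℝ, pNorm p x = 1 ∧ y = H.form x} (H.spectralRadius p) := by
  classical
  have hp0 : 0 < p := by linarith
  have hcont : Continuous (fun x : V → ℝ => pNorm p x) := by
    unfold pNorm
    refine Continuous.rpow_const (continuous_finsetSum _ fun v _ => ?_) fun _ => Or.inr (by positivity)
    exact Continuous.rpow_const (by fun_prop) fun _ => Or.inr hp0.le
  have hform : Continuous H.form := by
    unfold form
    fun_prop
  have hclosed : IsClosed {x : V → ℝ | pNorm p x = 1} := isClosed_eq hcont continuous_const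
  have hbd : {x : V → ℝ | pNorm p x = 1} ⊆ Set.Icc (fun _ => -1) (fun _ => 1) := by
    intro x hx
    have h1 : ∀ v, |x v| ≤ 1 := by
      intro v
      have hnn : 0 ≤ ∑ v, |x v| ^ p := Finset.sum_nonneg fun v _ => by positivity
      have hs : ∑ v, |x v| ^ p = 1 := by
        have hx' : (∑ v, |x v| ^ p) ^ (1 / p) = 1 := hx
        rw [one_div, Real.rpow_inv_eq hnn zero_le_one hp0.ne', Real.one_rpow] at hx'
        exact hx'
      have h2 : |x v| ^ p ≤ 1 := by
        rw [← hs]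
        exact Finset.single_le_sum (f := fun v => |x v| ^ p) (fun v _ => by positivity)
          (Finset.mem_univ v)
      by_contra hlt
      exact absurd h2 (not_le.mpr (Real.one_lt_rpow (not_le.mp hlt) hp0))
    exact ⟨fun v => (abs_le.mp (h1 v)).1, fun v => (abs_le.mp (h1 v)).2⟩
  have hcomp : IsCompact {x : V → ℝ | pNorm p x = 1} := isCompact_Icc.of_isClosed_subset hclosed hbd
  have hset : {y : ℝ | ∃ x : V → ℝ, pNorm p x = 1 ∧ y = H.form x}
      = H.form '' {x : V → ℝ | pNorm p x = 1} := by
    ext y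
    simp [eq_comm]
  have hne : {x : V → ℝ | pNorm p x = 1}.Nonempty := by
    refine ⟨Pi.single (Classical.arbitrary V) 1, ?_⟩
    have : ∀ v : V, |(Pi.single (Classical.arbitrary V) (1 : ℝ) : V → ℝ) v| ^ p
        = if v = Classical.arbitrary V then 1 else 0 := by
      intro v
      by_cases h : v = Classical.arbitrary V
      · subst h; simp
      · simp [h, hp0.ne']
    simp [pNorm, this]
  unfold spectralRadius
  rw [hset]
  exact (hcomp.image hform).isGreatest_sSup (hne.image _)

/-- The complete partite `r`-graph with vertex classes `c⁻¹(i)`, `i : Fin k`: its edges are all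
`r`-sets of vertices that meet each class in at most one vertex. -/
noncomputable def completePartite (r : ℕ) {k : ℕ} {V : Type*} [Fintype V] (c : V → Fin k) :
    RGraph r V where
  edges := by
    classical
    exact Finset.univ.filter fun e : Finset V => e.card = r ∧ Set.InjOn c (e : Set V)
  sized := by
    intro e he
    exact (Finset.mem_filter.mp (Finset.mem_coe.mp he)).2.1

/-- `T` is (a copy on the vertex set `V` of) the Turán `r`-graph `T_r(|V|, k)`: it is complete
`k`-partite and the sizes of any two of the `k` classes differ by at most one. -/
def IsTuran {r : ℕ} {V : Type*} [Fintype V] (k : ℕ) (T : RGraph r V) : Prop :=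
  ∃ c : V → Fin k,
    (∀ i j : Fin k, Nat.card {v : V // c v = i} ≤ Nat.card {v : V // c v = j} + 1) ∧
    T = completePartite r c

/-- `H` can be transformed into the Turán `r`-graph `T_r(|V|, k)` by adding and deleting at
most `m` edges in total. -/
def CloseToTuran {r : ℕ} {V : Type*} [Fintype V] [DecidableEq V] (k : ℕ) (m : ℝ)
    (H : RGraph r V) : Prop :=
  ∃ T : RGraph r V, T.IsTuran k ∧ ((symmDiff H.edges T.edges).card : ℝ) ≤ m

end RGraph

/-- The vertices of the expanded clique: the `t` core vertices, and `r - 2` private new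
vertices for every pair of core vertices. -/
abbrev ExpandedCliqueVertex (t r : ℕ) : Type :=
  Fin t ⊕ ({e : Finset (Fin t) // e.card = 2} × Fin (r - 2))

/-- The expanded clique `H_t^{(r)}`: every edge (pair) of the complete graph on `t` vertices is
enlarged by its own set of `r - 2` new vertices. -/
def expandedClique (t r : ℕ) (hr : 2 ≤ r) : RGraph r (ExpandedCliqueVertex t r) where
  edges := Finset.univ.image fun e : {e : Finset (Fin t) // e.card = 2} =>
    e.1.disjSum (({e} : Finset {e : Finset (Fin t) // e.card = 2}) ×ˢ Finset.univ)
  sized := by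
    intro s hs
    simp only [Finset.coe_image, Finset.coe_univ, Set.image_univ, Set.mem_range] at hs
    obtain ⟨e, rfl⟩ := hs
    rw [Finset.card_disjSum, e.2]
    simp
    omega

/-!
The proof passes from the `r`-graph `H` to an ordinary graph. Call a pair of vertices heavy if it
lies in more than `M n ^ (r - 3)` edges, where `M` is the number of vertices of the expanded
clique. A `K_{k+1}` of heavy pairs would extend greedily to a copy of `H_{k+1}^{(r)}`, so the graph
`G` of heavy pairs is `K_{k+1}`-free (`RGraph.cliqueFree_codegreeGraph`). All but
`M n ^ (r - 1)` edges of `H` contain heavy pairs only, that is, are `r`-cliques of `G`.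

The weighted Moon–Moser inequality (`SimpleGraph.moon_moser`), run downwards from the vanishing
weight of the `(k+1)`-cliques, shows that consecutive clique weights of `G` grow no faster than in
the balanced complete `k`-partite graph. This gives the Lagrangian bound
`SimpleGraph.cliqueWeight_le` for the vertex weights `|x_v| ^ p`. Hölder's inequality then bounds
the spectral radius by the number of edges to the power `1 - 1 / p`
(`RGraph.spectralRadius_le`); as `p > 1`, the deleted edges contribute a lower order, and a
nearly extremal spectral radius forces nearly `(k choose r) / k ^ r * n ^ r` cliques of size `r` in
`G` (`RGraph.exists_le_card_of_lt_spectralRadius`).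

With unit weights, the same growth bound converts many `r`-cliques into many edges of `G`.
Füredi's partition (`SimpleGraph.exists_coloring_card_add_card_le`) then yields a `k`-colouring of
`G` that is nearly equitable and has few monochromatic edges, and few vertices must be recoloured
to make it equitable (`exists_equitable_recoloring`). Since the complete `k`-partite `r`-graph has
at most `(k choose r) / k ^ r * n ^ r` edges, it is enough to count the edges of `H` outside it,
which is done in `RGraph.closeToTuran_of_le_card`.
-/

open Finset

/-! ### Clique weights of `K_{k+1}`-free graphs -/

namespace SimpleGraph

variable {V : Type*} [Fintype V] [DecidableEq V] (G : SimpleGraph V) [DecidableRel G.Adj]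

/-- The vertices adjacent to every vertex of `C`. -/
def commonNbrs (C : Finset V) : Finset V := {v | ∀ u ∈ C, G.Adj u v}

/-- The sum over the `s`-cliques of `G` of the product of the vertex weights `y`; with `y = 1`,
the number of `s`-cliques. -/
def cliqueWeight (y : V → ℝ) (s : ℕ) : ℝ := ∑ A ∈ G.cliqueFinset s, ∏ v ∈ A, y v

variable {G}

theorem mem_commonNbrs {C : Finset V} {v : V} : v ∈ G.commonNbrs C ↔ ∀ u ∈ C, G.Adj u v := by
  simp [commonNbrs]

theorem notMem_of_mem_commonNbrs {C : Finset V} {v : V} (h : v ∈ G.commonNbrs C) : v ∉ C :=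
  fun hv => G.loopless.irrefl v (mem_commonNbrs.mp h v hv)

theorem cliqueWeight_nonneg {y : V → ℝ} (hy : ∀ v, 0 ≤ y v) (s : ℕ) :
    0 ≤ G.cliqueWeight y s :=
  sum_nonneg fun _ _ => prod_nonneg fun v _ => hy v

theorem cliqueWeight_zero (y : V → ℝ) : G.cliqueWeight y 0 = 1 := by
  have : G.cliqueFinset 0 = {∅} := by
    ext A
    simp only [mem_cliqueFinset_iff, mem_singleton]
    constructor
    · intro h
      exact card_eq_zero.mp h.2
    · rintro rfl
      exact ⟨by simp, rfl⟩
  simp [cliqueWeight, this]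

/-- Removing a vertex from an `(s+1)`-clique, or adding a common neighbour to an `s`-clique. -/
theorem sum_cliqueFinset_succ (s : ℕ) (F : Finset V → V → ℝ) :
    ∑ A ∈ G.cliqueFinset (s + 1), ∑ a ∈ A, F (A.erase a) a =
      ∑ C ∈ G.cliqueFinset s, ∑ v ∈ G.commonNbrs C, F C v := by
  rw [sum_sigma', sum_sigma']
  refine sum_bij' (fun x _ => ⟨x.1.erase x.2, x.2⟩) (fun x _ => ⟨insert x.2 x.1, x.2⟩)
    ?_ ?_ ?_ ?_ ?_
  · rintro ⟨A, a⟩ h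
    simp only [mem_sigma, mem_cliqueFinset_iff, mem_commonNbrs] at h ⊢
    refine ⟨⟨h.1.1.subset (by simp), by rw [card_erase_of_mem h.2, h.1.2]; rfl⟩, ?_⟩
    intro u hu
    exact h.1.1 (mem_of_mem_erase hu) h.2 (ne_of_mem_erase hu)
  · rintro ⟨C, v⟩ h
    simp only [mem_sigma, mem_cliqueFinset_iff] at h ⊢
    refine ⟨h.1.insert fun u hu => (mem_commonNbrs.mp h.2 u hu).symm, by simp⟩
  · rintro ⟨A, a⟩ h
    simp only [mem_sigma] at h
    simp [insert_erase h.2]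
  · rintro ⟨C, v⟩ h
    simp only [mem_sigma] at h
    simp [erase_insert (notMem_of_mem_commonNbrs h.2)]
  · rintro ⟨A, a⟩ h
    rfl

theorem succ_mul_cliqueWeight_succ (y : V → ℝ) (s : ℕ) :
    ((s : ℝ) + 1) * G.cliqueWeight y (s + 1) =
      ∑ C ∈ G.cliqueFinset s, (∏ v ∈ C, y v) * ∑ v ∈ G.commonNbrs C, y v := by
  have h := sum_cliqueFinset_succ (G := G) s (fun C v => (∏ u ∈ C, y u) * y v)
  simp only [← mul_sum] at h
  rw [← h, cliqueWeight, mul_sum]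
  refine sum_congr rfl fun A hA => ?_
  have hc : A.card = s + 1 := ((mem_cliqueFinset_iff).mp hA).2
  rw [sum_congr rfl (fun a ha => prod_erase_mul A y ha), sum_const, hc]
  simp

/-- A vertex `b` outside the common neighbourhood of a clique `A` is a common neighbour of
`A.erase a` for at most one `a`. -/
theorem card_filter_commonNbrs_erase_le (A : Finset V) (b : V) :
    #{a ∈ A | b ∈ G.commonNbrs (A.erase a)} ≤
      1 + if b ∈ G.commonNbrs A then A.card - 1 else 0 := by
  split_ifs with h
  · have := card_filter_le A (fun a => b ∈ G.commonNbrs (A.erase a))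
    omega
  · rw [add_zero, card_le_one]
    intro a ha a' ha'
    simp only [mem_filter, mem_commonNbrs, mem_erase] at ha ha'
    by_contra hne
    refine h (mem_commonNbrs.mpr fun u hu => ?_)
    by_cases hua : u = a
    · exact ha'.2 u ⟨fun e => hne (hua ▸ e), hu⟩
    · exact ha.2 u ⟨hua, hu⟩

/-- The weighted Moon–Moser inequality. By Cauchy–Schwarz the left side is at most the weight of
the `s`-cliques times the weight of the triples `(C, a, b)` with `a`, `b` common neighbours of the
`s`-clique `C`; regrouping by the `(s+1)`-clique `insert a C`, a vertex `b` counts at most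
once, or `s + 1` times if it extends that clique. -/
theorem moon_moser {y : V → ℝ} (hy : ∀ v, 0 ≤ y v) (s : ℕ) :
    (((s : ℝ) + 1) * G.cliqueWeight y (s + 1)) ^ 2 ≤
      G.cliqueWeight y s * ((∑ v, y v) * G.cliqueWeight y (s + 1) +
        s * ((s + 2) * G.cliqueWeight y (s + 2))) := by
  set w : Finset V → ℝ := fun A => ∏ v ∈ A, y v with hw
  set d : Finset V → ℝ := fun A => ∑ v ∈ G.commonNbrs A, y v with hd
  have hw0 : ∀ A, 0 ≤ w A := fun A => prod_nonneg fun v _ => hy v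
  have hcs : (∑ C ∈ G.cliqueFinset s, w C * d C) ^ 2 ≤
      (∑ C ∈ G.cliqueFinset s, w C) * ∑ C ∈ G.cliqueFinset s, w C * d C ^ 2 := by
    refine sum_sq_le_sum_mul_sum_of_sq_le_mul _ (fun C _ => hw0 C)
      (fun C _ => mul_nonneg (hw0 C) (sq_nonneg _)) fun C _ => le_of_eq (by ring)
  rw [succ_mul_cliqueWeight_succ]
  refine hcs.trans (mul_le_mul_of_nonneg_left ?_ (cliqueWeight_nonneg hy s))
  have h := sum_cliqueFinset_succ (G := G) s (fun C v => w C * y v * d C)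
  have h1 : ∑ C ∈ G.cliqueFinset s, w C * d C ^ 2 =
      ∑ A ∈ G.cliqueFinset (s + 1), w A * ∑ a ∈ A, d (A.erase a) := by
    calc ∑ C ∈ G.cliqueFinset s, w C * d C ^ 2
        = ∑ C ∈ G.cliqueFinset s, ∑ v ∈ G.commonNbrs C, w C * y v * d C := by
          refine sum_congr rfl fun C _ => ?_
          rw [← sum_mul, ← mul_sum]
          ring
      _ = _ := by
          rw [← h]
          refine sum_congr rfl fun A _ => ?_
          rw [mul_sum]
          refine sum_congr rfl fun a ha => ?_
          rw [hw]
          simp only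
          rw [prod_erase_mul A y ha]
  have h2 : ((s : ℝ) + 2) * G.cliqueWeight y (s + 2) =
      ∑ A ∈ G.cliqueFinset (s + 1), w A * d A := by
    have := succ_mul_cliqueWeight_succ (G := G) y (s + 1)
    rw [← this]
    push_cast
    ring
  rw [h1, h2, cliqueWeight, mul_sum, mul_sum, ← sum_add_distrib]
  refine sum_le_sum fun A hA => ?_
  have hc : A.card = s + 1 := ((mem_cliqueFinset_iff).mp hA).2
  have h3 : ∑ a ∈ A, d (A.erase a) ≤ (∑ v, y v) + s * d A := by
    calc ∑ a ∈ A, d (A.erase a)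
        = ∑ a ∈ A, ∑ b, if b ∈ G.commonNbrs (A.erase a) then y b else 0 := by
          refine sum_congr rfl fun a _ => ?_
          rw [← sum_filter, filter_mem_eq_inter, univ_inter]
      _ = ∑ b, (#{a ∈ A | b ∈ G.commonNbrs (A.erase a)} : ℝ) * y b := by
          rw [sum_comm]
          refine sum_congr rfl fun b _ => ?_
          rw [← sum_filter, sum_const, nsmul_eq_mul]
      _ ≤ ∑ b, (1 + s * if b ∈ G.commonNbrs A then 1 else 0) * y b := by
          refine sum_le_sum fun b _ => mul_le_mul_of_nonneg_right ?_ (hy b)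
          have := card_filter_commonNbrs_erase_le (G := G) A b
          rw [hc] at this
          split_ifs at this ⊢ <;>
          · have := (Nat.cast_le (α := ℝ)).mpr this
            push_cast at this
            simpa using this
      _ = _ := by
          simp only [add_mul, one_mul, sum_add_distrib, mul_assoc, ← mul_sum, ite_mul, zero_mul]
          rw [← sum_filter, filter_mem_eq_inter, univ_inter]
  calc w A * ∑ a ∈ A, d (A.erase a) ≤ w A * ((∑ v, y v) + s * d A) :=
        mul_le_mul_of_nonneg_left h3 (hw0 A)
    _ = _ := by ring

theorem cliqueWeight_eq_zero {k : ℕ} (hG : G.CliqueFree (k + 1)) (y : V → ℝ) :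
    G.cliqueWeight y (k + 1) = 0 := by
  rw [cliqueWeight, cliqueFinset_eq_empty_iff.mpr hG, sum_empty]

/-- Consecutive clique weights of a `K_{k+1}`-free graph grow at most as in the balanced
complete `k`-partite graph. -/
theorem cliqueWeight_succ_le {k s : ℕ} (hG : G.CliqueFree (k + 1)) {y : V → ℝ}
    (hy : ∀ v, 0 ≤ y v) (hs : s ≤ k) :
    ((s : ℝ) + 1) * k * G.cliqueWeight y (s + 1) ≤
      ((k : ℝ) - s) * (∑ v, y v) * G.cliqueWeight y s := by
  induction hs using Nat.decreasingInduction with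
  | self => simp [cliqueWeight_eq_zero hG]
  | of_succ s hs ih =>
    have hmm := moon_moser (G := G) hy s
    have hk : (0 : ℝ) < k := by exact_mod_cast (show 0 < k by omega)
    have hsk : (s : ℝ) + 1 ≤ k := by exact_mod_cast hs
    have hY : 0 ≤ ∑ v, y v := sum_nonneg fun v _ => hy v
    have h0 := cliqueWeight_nonneg (G := G) hy s
    have h1 := cliqueWeight_nonneg (G := G) hy (s + 1)
    push_cast at ih
    set W0 := G.cliqueWeight y s
    set W1 := G.cliqueWeight y (s + 1)
    set W2 := G.cliqueWeight y (s + 1 + 1)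
    set Y := ∑ v, y v
    have hs0 : (0 : ℝ) ≤ s := Nat.cast_nonneg s
    rcases h1.eq_or_lt with h1 | h1
    · rw [← h1, mul_zero]
      have : 0 ≤ (k : ℝ) - s := by linarith
      positivity
    · have e1 : k * ((s + 1) * W1) ^ 2 ≤ W0 * (k * (Y * W1) + s * ((k - (s + 1)) * Y * W1)) := by
        calc k * (((s : ℝ) + 1) * W1) ^ 2 ≤ k * (W0 * (Y * W1 + s * ((s + 2) * W2))) :=
              mul_le_mul_of_nonneg_left hmm hk.le
          _ = W0 * (k * (Y * W1) + s * ((s + 1 + 1) * k * W2)) := by ring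
          _ ≤ _ := by gcongr
      have hpos : 0 < ((s : ℝ) + 1) * W1 := by positivity
      refine le_of_mul_le_mul_left ?_ hpos
      calc (s + 1) * W1 * ((s + 1) * k * W1) = k * ((s + 1) * W1) ^ 2 := by ring
        _ ≤ _ := e1
        _ = _ := by ring

theorem _root_.Nat.choose_succ_div_pow (k s : ℕ) (hk : 0 < k) (hs : s ≤ k) :
    ((s : ℝ) + 1) * k * ((k.choose (s + 1) : ℝ) / (k : ℝ) ^ (s + 1)) =
      ((k : ℝ) - s) * ((k.choose s : ℝ) / (k : ℝ) ^ s) := by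
  have hk' : (k : ℝ) ≠ 0 := by positivity
  have := congrArg (Nat.cast (R := ℝ)) (Nat.choose_succ_right_eq k s)
  push_cast [Nat.cast_sub hs] at this
  rw [pow_succ]
  field_simp
  linarith

/-- In a `K_{k+1}`-free graph, many large cliques force many small ones, with the ratio of the
balanced complete `k`-partite graph. -/
theorem cliqueWeight_add_le {k : ℕ} (hk : 0 < k) (hG : G.CliqueFree (k + 1)) {y : V → ℝ}
    (hy : ∀ v, 0 ≤ y v) (j i : ℕ) (hij : j + i ≤ k) :
    (k.choose j : ℝ) / (k : ℝ) ^ j * G.cliqueWeight y (j + i) ≤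
      (k.choose (j + i) : ℝ) / (k : ℝ) ^ (j + i) * (∑ v, y v) ^ i * G.cliqueWeight y j := by
  induction i with
  | zero => simp
  | succ i ih =>
    have ih := ih (by omega)
    have h1 := cliqueWeight_succ_le hG hy (show j + i ≤ k by omega)
    have h2 := Nat.choose_succ_div_pow k (j + i) hk (by omega)
    have hY : 0 ≤ ∑ v, y v := sum_nonneg fun v _ => hy v
    have hsk : ((j + i : ℕ) : ℝ) ≤ k := by exact_mod_cast (show j + i ≤ k by omega)
    rw [← add_assoc]
    set a := (k.choose j : ℝ) / (k : ℝ) ^ j with ha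
    have ha0 : 0 ≤ a := by positivity
    set b := (k.choose (j + i) : ℝ) / (k : ℝ) ^ (j + i)
    set b' := (k.choose (j + i + 1) : ℝ) / (k : ℝ) ^ (j + i + 1)
    set t : ℝ := ((j + i : ℕ) : ℝ)
    have ht : 0 ≤ (k : ℝ) - t := by linarith
    have hpos : 0 < (t + 1) * k := by positivity
    refine le_of_mul_le_mul_left ?_ hpos
    calc (t + 1) * k * (a * G.cliqueWeight y (j + i + 1))
        = a * ((t + 1) * k * G.cliqueWeight y (j + i + 1)) := by ring
      _ ≤ a * ((k - t) * (∑ v, y v) * G.cliqueWeight y (j + i)) := by gcongr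
      _ = (k - t) * (∑ v, y v) * (a * G.cliqueWeight y (j + i)) := by ring
      _ ≤ (k - t) * (∑ v, y v) * (b * (∑ v, y v) ^ i * G.cliqueWeight y j) := by gcongr
      _ = ((k - t) * b) * (∑ v, y v) ^ (i + 1) * G.cliqueWeight y j := by ring
      _ = _ := by rw [← h2]; ring

/-- The Lagrangian bound: a `K_{k+1}`-free graph has at most the clique weight of the balanced
complete `k`-partite graph. -/
theorem cliqueWeight_le {k r : ℕ} (hk : 0 < k) (hr : r ≤ k) (hG : G.CliqueFree (k + 1))
    {y : V → ℝ} (hy : ∀ v, 0 ≤ y v) :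
    G.cliqueWeight y r ≤ (k.choose r : ℝ) / (k : ℝ) ^ r * (∑ v, y v) ^ r := by
  have := cliqueWeight_add_le hk hG hy 0 r (by omega)
  simpa [cliqueWeight_zero] using this

end SimpleGraph

/-! ### Füredi's partition -/

namespace SimpleGraph

variable {V : Type*} [DecidableEq V] {G : SimpleGraph V} [DecidableRel G.Adj]

/-- Counting the pairs of `A × A` by membership in `B ⊆ A`, for a symmetric relation. -/
theorem card_filter_product_eq {R : V → V → Prop} [DecidableRel R] (hR : ∀ u v, R u v → R v u)
    {A B : Finset V} (hB : B ⊆ A) :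
    #{x ∈ A ×ˢ A | R x.1 x.2} = #{x ∈ B ×ˢ B | R x.1 x.2} +
      (∑ u ∈ A \ B, #{v ∈ A | R u v} + ∑ u ∈ A \ B, #{v ∈ B | R u v}) := by
  have hprod : ∀ S T : Finset V, #{x ∈ S ×ˢ T | R x.1 x.2} = ∑ u ∈ S, #{v ∈ T | R u v} := by
    intro S T
    simp only [card_filter, sum_product]
  have hsplit : ∀ u, #{v ∈ A | R u v} = #{v ∈ B | R u v} + #{v ∈ A \ B | R u v} := by
    intro u
    simp only [card_filter]
    rw [add_comm, sum_sdiff hB]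
  have hswap : ∑ u ∈ B, #{v ∈ A \ B | R u v} = ∑ u ∈ A \ B, #{v ∈ B | R u v} := by
    simp only [card_filter]
    rw [sum_comm]
    refine sum_congr rfl fun u _ => sum_congr rfl fun v _ => ?_
    simp only [show R v u ↔ R u v from ⟨hR _ _, hR _ _⟩]
  rw [hprod, hprod, ← sum_sdiff hB, sum_congr rfl (fun u (_ : u ∈ B) => hsplit u),
    sum_add_distrib, hswap]
  ring

/-- Füredi's partition: choose `x` of maximum degree in `A`, give the non-neighbours of `x` a
colour of their own, and continue inside the neighbourhood of `x`. All counts are of ordered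
pairs. -/
theorem exists_coloring_card_add_card_le (k : ℕ) (A : Finset V)
    (hA : ∀ S ⊆ A, ¬ G.IsNClique (k + 1) S) :
    ∃ c : V → ℕ, (∀ v ∈ A, c v < k) ∧
      #{x ∈ A ×ˢ A | G.Adj x.1 x.2} + #{x ∈ A ×ˢ A | G.Adj x.1 x.2 ∧ c x.1 = c x.2} +
        #{x ∈ A ×ˢ A | c x.1 = c x.2} ≤ #A ^ 2 := by
  induction k generalizing A with
  | zero =>
    have : A = ∅ := by
      refine eq_empty_of_forall_notMem fun a ha => hA {a} (by simpa) ?_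
      exact ⟨by simp, by simp⟩
    subst this
    exact ⟨fun _ => 0, by simp⟩
  | succ k ih =>
    rcases A.eq_empty_or_nonempty with rfl | hne
    · exact ⟨fun _ => 0, by simp⟩
    obtain ⟨x, hx, hmax⟩ := exists_max_image A (fun u => #{v ∈ A | G.Adj u v}) hne
    set B : Finset V := {v ∈ A | G.Adj x v} with hBdef
    have hBA : B ⊆ A := filter_subset _ _
    obtain ⟨c, hc, hcount⟩ := ih B fun S hS hcl => by
      refine hA (insert x S) (insert_subset hx (hS.trans hBA)) ?_
      exact hcl.insert fun b hb => (mem_filter.mp (hS hb)).2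
    set c' : V → ℕ := fun v => if v ∈ B then c v else k with hc'
    have hcB : ∀ v ∈ B, c' v = c v := fun v hv => by simp [hc', hv]
    have hcU : ∀ v ∈ A \ B, c' v = k := fun v hv => by simp [hc', (mem_sdiff.mp hv).2]
    refine ⟨c', ?_, ?_⟩
    · intro v hv
      by_cases h : v ∈ B
      · rw [hcB v h]
        exact (hc v h).trans (Nat.lt_succ_self k)
      · rw [hcU v (mem_sdiff.mpr ⟨hv, h⟩)]
        exact Nat.lt_succ_self k
    · have hne' : ∀ u ∈ A \ B, ∀ v ∈ B, c' u ≠ c' v := by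
        intro u hu v hv
        rw [hcU u hu, hcB v hv]
        exact (hc v hv).ne'
      have hiff : ∀ u ∈ A \ B, ∀ v ∈ A, (c' u = c' v ↔ v ∈ A \ B) := by
        intro u hu v hv
        by_cases h : v ∈ B
        · simp [hne' u hu v h, h]
        · have : v ∈ A \ B := mem_sdiff.mpr ⟨hv, h⟩
          simp [hcU u hu, hcU v this, this, -mem_sdiff]
      rw [card_filter_product_eq (R := G.Adj) (fun _ _ h => h.symm) hBA,
        card_filter_product_eq (R := fun u v => G.Adj u v ∧ c' u = c' v)
          (fun _ _ h => ⟨h.1.symm, h.2.symm⟩) hBA,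
        card_filter_product_eq (R := fun u v => c' u = c' v) (fun _ _ h => h.symm) hBA]
      have e1 : #{x ∈ B ×ˢ B | G.Adj x.1 x.2 ∧ c' x.1 = c' x.2} =
          #{x ∈ B ×ˢ B | G.Adj x.1 x.2 ∧ c x.1 = c x.2} := by
        congr 1
        refine filter_congr fun x hx => ?_
        rw [hcB _ (mem_product.mp hx).1, hcB _ (mem_product.mp hx).2]
      have e2 : #{x ∈ B ×ˢ B | c' x.1 = c' x.2} = #{x ∈ B ×ˢ B | c x.1 = c x.2} := by
        congr 1
        refine filter_congr fun x hx => ?_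
        rw [hcB _ (mem_product.mp hx).1, hcB _ (mem_product.mp hx).2]
      have e3 : ∑ u ∈ A \ B, #{v ∈ B | G.Adj u v ∧ c' u = c' v} = 0 :=
        sum_eq_zero fun u hu => card_eq_zero.mpr <| filter_eq_empty_iff.mpr
          fun v hv h => hne' u hu v hv h.2
      have e4 : ∑ u ∈ A \ B, #{v ∈ B | c' u = c' v} = 0 :=
        sum_eq_zero fun u hu => card_eq_zero.mpr <| filter_eq_empty_iff.mpr
          fun v hv h => hne' u hu v hv h
      have e5 : ∑ u ∈ A \ B, #{v ∈ A | c' u = c' v} = #(A \ B) * #(A \ B) := by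
        rw [← smul_eq_mul, ← sum_const]
        refine sum_congr rfl fun u hu => ?_
        congr 1
        rw [filter_congr (hiff u hu), filter_mem_eq_inter, inter_eq_right.mpr sdiff_subset]
      have e6 : ∑ u ∈ A \ B, #{v ∈ B | G.Adj u v} +
          ∑ u ∈ A \ B, #{v ∈ A | G.Adj u v ∧ c' u = c' v} =
            ∑ u ∈ A \ B, #{v ∈ A | G.Adj u v} := by
        rw [← sum_add_distrib]
        refine sum_congr rfl fun u hu => ?_
        have : #{v ∈ A | G.Adj u v ∧ c' u = c' v} = #{v ∈ A \ B | G.Adj u v} := by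
          congr 1
          ext v
          simp only [mem_filter]
          constructor
          · rintro ⟨hv, h, h'⟩
            exact ⟨(hiff u hu v hv).mp h', h⟩
          · rintro ⟨hv, h⟩
            have hv' := (mem_sdiff.mp hv).1
            exact ⟨hv', h, (hiff u hu v hv').mpr hv⟩
        rw [this]
        simp only [card_filter]
        rw [add_comm, sum_sdiff hBA]
      have e7 : ∑ u ∈ A \ B, #{v ∈ A | G.Adj u v} ≤ #(A \ B) * #B := by
        rw [← smul_eq_mul]
        exact sum_le_card_nsmul _ _ _ fun u hu => hmax u (mem_sdiff.mp hu).1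
      have e8 : #A = #(A \ B) + #B := (card_sdiff_add_card_eq_card hBA).symm
      rw [e1, e2, e3, e4, e5, e8]
      nlinarith [hcount, e6, e7]

end SimpleGraph

/-! ### Equitable recolouring -/

/-- Any colouring can be made equitable by recolouring only the vertices by which the colour
classes exceed their average size. -/
theorem exists_equitable_recoloring {n k : ℕ} (hk : 0 < k) (c : Fin n → Fin k) :
    ∃ c' : Fin n → Fin k,
      (∀ i j : Fin k, Nat.card {v // c' v = i} ≤ Nat.card {v // c' v = j} + 1) ∧
      #{v | c' v ≠ c v} ≤ ∑ i, (#{v | c v = i} - n / k) := by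
  -- `rk v` is the rank of `v` in its colour class; `f` lists the vertices of colour `i` along
  -- the residue class of `i` modulo `k`.
  set rk : Fin n → ℕ := fun v => #{u | u < v ∧ c u = c v} with hrk
  have hrk_lt : ∀ u v, c u = c v → u < v → rk u < rk v := by
    intro u v huv hlt
    refine card_lt_card ⟨fun w hw => ?_, fun h => ?_⟩
    · simp only [mem_filter, mem_univ, true_and] at hw ⊢
      exact ⟨hw.1.trans hlt, hw.2.trans huv⟩
    · have : u ∈ ({w | w < u ∧ c w = c u} : Finset (Fin n)) := h (by simp [hlt, huv])
      simp at this
  have hrk_inj : ∀ u v, c u = c v → rk u = rk v → u = v := by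
    intro u v huv h
    rcases lt_trichotomy u v with hlt | heq | hlt
    · exact absurd h (hrk_lt u v huv hlt).ne
    · exact heq
    · exact absurd h (hrk_lt v u huv.symm hlt).ne'
  set f : Fin n → ℕ := fun v => c v + k * rk v with hf
  have hfmod : ∀ v, f v % k = c v := by
    intro v
    simp [hf, Nat.add_mul_mod_self_left, Nat.mod_eq_of_lt (c v).2]
  have hfdiv : ∀ v, f v / k = rk v := by
    intro v
    simp [hf, Nat.add_mul_div_left _ _ hk, Nat.div_eq_of_lt (c v).2]
  have hfinj : Function.Injective f := by
    intro u v h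
    refine hrk_inj u v (Fin.ext ?_) ?_
    · rw [← hfmod, ← hfmod, h]
    · rw [← hfdiv, ← hfdiv, h]
  obtain ⟨g, hg⟩ := Finset.exists_equiv_extend_of_card_eq (t := range n) (by simp)
    (s := ({v | f v < n} : Finset (Fin n))) (f := f)
    (by intro x hx; simp only [mem_image, mem_filter, mem_univ, true_and] at hx
        obtain ⟨v, hv, rfl⟩ := hx
        simpa using hv) hfinj.injOn
  refine ⟨fun v => ⟨(g v : ℕ) % k, Nat.mod_lt _ hk⟩, ?_, ?_⟩
  · have hcard : ∀ i : Fin k, Nat.card {v // (⟨(g v : ℕ) % k, Nat.mod_lt _ hk⟩ : Fin k) = i} =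
        n / k + if (i : ℕ) < n % k then 1 else 0 := by
      intro i
      have h := Nat.count_modEq_card n hk i
      rw [Nat.mod_eq_of_lt i.2] at h
      rw [← h, Nat.count_eq_card_filter_range, Nat.card_eq_fintype_card, Fintype.card_subtype]
      refine card_bij (fun v _ => (g v : ℕ)) ?_ ?_ ?_
      · intro v hv
        simp only [mem_filter, mem_univ, true_and, Fin.ext_iff] at hv
        simp only [mem_filter]
        refine ⟨(g v).2, ?_⟩
        rw [Nat.ModEq, hv, Nat.mod_eq_of_lt i.2]
      · intro u _ v _ h
        exact g.injective (Subtype.ext h)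
      · intro b hb
        simp only [mem_filter] at hb
        refine ⟨g.symm ⟨b, hb.1⟩, ?_, by simp⟩
        simp only [mem_filter, mem_univ, true_and, Fin.ext_iff, Equiv.apply_symm_apply]
        rw [hb.2, Nat.mod_eq_of_lt i.2]
    intro i j
    rw [hcard, hcard]
    split_ifs <;> omega
  · calc #{v | (⟨(g v : ℕ) % k, Nat.mod_lt _ hk⟩ : Fin k) ≠ c v}
        ≤ #{v | n / k ≤ rk v} := by
          refine card_le_card fun v hv => ?_
          simp only [mem_filter, mem_univ, true_and] at hv ⊢
          by_contra hlt
          refine hv (Fin.ext ?_)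
          have hfn : f v < n := by
            have h1 : (rk v + 1) * k ≤ n / k * k := Nat.mul_le_mul_right k (by omega)
            have h2 := Nat.div_mul_le_self n k
            have h3 := (c v).2
            simp only [hf]
            nlinarith
          simp only
          rw [hg v (by simpa using hfn), hfmod]
      _ = ∑ i, #{v | c v = i ∧ n / k ≤ rk v} := by
          rw [card_eq_sum_card_fiberwise (f := c) (t := univ) (by simp)]
          refine sum_congr rfl fun i _ => ?_
          rw [filter_filter]
          simp only [and_comm]
      _ ≤ ∑ i, (#{v | c v = i} - n / k) := by
          refine sum_le_sum fun i _ => ?_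
          rw [← Nat.card_Ico]
          refine card_le_card_of_injOn rk ?_ ?_
          · intro v hv
            simp only [coe_filter, Set.mem_ofPred_eq, mem_univ, true_and] at hv
            simp only [coe_Ico, Set.mem_Ico]
            refine ⟨hv.2, card_lt_card ⟨fun w hw => ?_, fun h => ?_⟩⟩
            · simp only [mem_filter, mem_univ, true_and] at hw ⊢
              exact hw.2.trans hv.1
            · have : v ∈ ({u | u < v ∧ c u = c v} : Finset (Fin n)) := h (by simp [hv.1])
              simp at this
          · intro u hu v hv h
            simp only [coe_filter, Set.mem_ofPred_eq, mem_univ, true_and] at hu hv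
            exact hrk_inj u v (hu.1.trans hv.1.symm) h

/-! ### Pairs of large codegree -/

namespace RGraph

variable {r : ℕ} {V : Type*} [Fintype V] [DecidableEq V]

theorem card_filter_superset_le (H : RGraph r V) (T : Finset V) :
    #{e ∈ H.edges | T ⊆ e} ≤ Fintype.card V ^ (r - #T) := by
  calc #{e ∈ H.edges | T ⊆ e} ≤ #(powersetCard (r - #T) (univ : Finset V)) := by
        refine card_le_card_of_injOn (· \ T) ?_ ?_
        · intro e he
          simp only [coe_filter, Set.mem_ofPred_eq] at he
          exact mem_powersetCard.mpr ⟨subset_univ _, by rw [card_sdiff_of_subset he.2, H.sized he.1]⟩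
        · intro e he e' he' h
          simp only [coe_filter, Set.mem_ofPred_eq] at he he'
          rw [← sdiff_union_of_subset he.2, ← sdiff_union_of_subset he'.2]
          exact congrArg (· ∪ T) h
    _ ≤ Fintype.card V ^ (r - #T) := by
        rw [card_powersetCard, card_univ]
        exact Nat.choose_le_pow _ _

/-- The graph of the pairs of vertices that lie together in more than `m` edges of `H`. -/
def codegreeGraph (H : RGraph r V) (m : ℕ) : SimpleGraph V where
  Adj u v := u ≠ v ∧ m < #{e ∈ H.edges | {u, v} ⊆ e}
  symm := ⟨fun u v h => ⟨h.1.symm, by rw [pair_comm]; exact h.2⟩⟩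
  loopless := ⟨fun _ h => h.1 rfl⟩

/-- A pair of large codegree has an edge that avoids any given small set of vertices. -/
theorem exists_edge_disjoint_sdiff {H : RGraph r V} {u v : V} (huv : u ≠ v) {X : Finset V}
    (h : #X * Fintype.card V ^ (r - 3) < #{e ∈ H.edges | {u, v} ⊆ e}) :
    ∃ e ∈ H.edges, {u, v} ⊆ e ∧ Disjoint (e \ {u, v}) X := by
  by_contra! hcon
  refine h.not_ge ?_
  calc #{e ∈ H.edges | {u, v} ⊆ e}
      ≤ #((X \ {u, v}).biUnion fun w => {e ∈ H.edges | {w, u, v} ⊆ e}) := by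
        refine card_le_card fun e he => ?_
        rw [mem_filter] at he
        obtain ⟨w, hw, hwX⟩ := not_disjoint_iff.mp (hcon e he.1 he.2)
        rw [mem_sdiff] at hw
        rw [mem_biUnion]
        refine ⟨w, mem_sdiff.mpr ⟨hwX, hw.2⟩, mem_filter.mpr ⟨he.1, ?_⟩⟩
        exact insert_subset hw.1 he.2
    _ ≤ ∑ w ∈ X \ {u, v}, #{e ∈ H.edges | {w, u, v} ⊆ e} := card_biUnion_le
    _ ≤ ∑ w ∈ X \ {u, v}, Fintype.card V ^ (r - 3) := by
        refine sum_le_sum fun w hw => ?_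
        have hw' := (mem_sdiff.mp hw).2
        have : #{w, u, v} = 3 := by
          rw [card_insert_of_notMem hw', card_pair huv]
        rw [← this]
        exact card_filter_superset_le H _
    _ ≤ #X * Fintype.card V ^ (r - 3) := by
        rw [sum_const, smul_eq_mul]
        exact Nat.mul_le_mul_right _ (card_le_card sdiff_subset)

/-- In an `H_t^{(r)}`-free `r`-graph the pairs of large codegree contain no `K_t`: a clique of
such pairs would extend greedily to a copy of the expanded clique. -/
theorem cliqueFree_codegreeGraph {H : RGraph r V} {t : ℕ} (hr : 2 ≤ r)
    (hH : H.Free (expandedClique t r hr)) :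
    (H.codegreeGraph
      (Fintype.card (ExpandedCliqueVertex t r) * Fintype.card V ^ (r - 3))).CliqueFree t := by
  classical
  by_contra hcl
  have φ := SimpleGraph.topEmbeddingOfNotCliqueFree hcl
  have hφ : ∀ i j, i ≠ j → Fintype.card (ExpandedCliqueVertex t r) * Fintype.card V ^ (r - 3) <
      #{e ∈ H.edges | {φ i, φ j} ⊆ e} := fun i j hij =>
    (φ.map_adj_iff.mpr ((SimpleGraph.top_adj _ _).mpr hij)).2
  set core : Finset V := univ.image φ with hcore
  -- Private vertex sets for the pairs in `Q`.
  have key : ∀ Q : Finset {e : Finset (Fin t) // e.card = 2},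
      ∃ S : {e : Finset (Fin t) // e.card = 2} → Finset V,
        (∀ e ∈ Q, #(S e) = r - 2 ∧ Disjoint (S e) core ∧ e.1.image φ ∪ S e ∈ H.edges) ∧
        (∀ e ∈ Q, ∀ e' ∈ Q, e ≠ e' → Disjoint (S e) (S e')) := by
    intro Q
    induction Q using Finset.induction_on with
    | empty => exact ⟨fun _ => ∅, by simp⟩
    | insert a Q ha ih =>
      obtain ⟨S, hS, hdisj⟩ := ih
      obtain ⟨i, j, hij, hea⟩ := card_eq_two.mp a.2
      set X := core ∪ Q.biUnion S with hX
      have hXcard : #X ≤ Fintype.card (ExpandedCliqueVertex t r) := by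
        calc #X ≤ #core + #(Q.biUnion S) := card_union_le _ _
          _ ≤ t + #Q * (r - 2) := by
              gcongr
              · exact card_image_le.trans (by simp)
              · exact card_biUnion_le_card_mul _ _ _ fun e he => (hS e he).1.le
          _ ≤ _ := by
              rw [Fintype.card_sum, Fintype.card_prod, Fintype.card_fin, Fintype.card_fin]
              gcongr
              exact card_le_univ Q
      obtain ⟨e, heH, hsub, hdX⟩ := exists_edge_disjoint_sdiff (H := H) (u := φ i) (v := φ j)
        (X := X) (φ.injective.ne hij)
        ((Nat.mul_le_mul_right _ hXcard).trans_lt (hφ i j hij))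
      rw [hX, disjoint_union_right, disjoint_biUnion_right] at hdX
      refine ⟨Function.update S a (e \ {φ i, φ j}), ?_, ?_⟩
      · intro b hb
        rcases eq_or_ne b a with rfl | hba
        · rw [Function.update_self]
          refine ⟨?_, hdX.1, ?_⟩
          · rw [card_sdiff_of_subset hsub, H.sized heH, card_pair (φ.injective.ne hij)]
          · rw [hea, image_insert, image_singleton, union_sdiff_of_subset hsub]
            exact heH
        · rw [Function.update_of_ne hba]
          exact hS b (mem_of_mem_insert_of_ne hb hba)
      · intro b hb b' hb' hne
        rcases eq_or_ne b a with rfl | hba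
        · rw [Function.update_self, Function.update_of_ne hne.symm]
          exact hdX.2 b' (mem_of_mem_insert_of_ne hb' hne.symm)
        · rw [Function.update_of_ne hba]
          rcases eq_or_ne b' a with rfl | hba'
          · rw [Function.update_self]
            exact (hdX.2 b (mem_of_mem_insert_of_ne hb hba)).symm
          · rw [Function.update_of_ne hba']
            exact hdisj b (mem_of_mem_insert_of_ne hb hba) b'
              (mem_of_mem_insert_of_ne hb' hba') hne
  obtain ⟨S, hS, hdisj⟩ := key univ
  have hS1 := fun e => (hS e (mem_univ e)).1
  have hS2 := fun e => (hS e (mem_univ e)).2.1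
  have hS3 := fun e => (hS e (mem_univ e)).2.2
  set ψ : {e : Finset (Fin t) // e.card = 2} × Fin (r - 2) → V :=
    fun x => ((S x.1).equivFinOfCardEq (hS1 x.1)).symm x.2 with hψ
  have hψS : ∀ x, ψ x ∈ S x.1 := fun x => coe_mem _
  have hψinj : Function.Injective ψ := by
    rintro ⟨e, j⟩ ⟨e', j'⟩ h
    have hee : e = e' := by
      by_contra hne
      exact disjoint_left.mp (hdisj e (mem_univ _) e' (mem_univ _) hne) (hψS (e, j))
        (h ▸ hψS (e', j'))
    subst hee
    exact congrArg (Prod.mk e) (((S e).equivFinOfCardEq (hS1 e)).symm.injective (Subtype.ext h))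
  have hinj : Function.Injective (Sum.elim φ ψ) := by
    refine φ.injective.sumElim hψinj fun i x h => ?_
    exact disjoint_left.mp (hS2 x.1) (h ▸ hψS x) (mem_image_of_mem φ (mem_univ i))
  refine hH ⟨⟨Sum.elim φ ψ, hinj⟩, ?_⟩
  intro s hs
  obtain ⟨e, -, rfl⟩ := mem_image.mp hs
  convert hS3 e using 1
  ext v
  simp only [mem_map, mem_union, mem_image, Function.Embedding.coeFn_mk, Sum.exists,
    inl_mem_disjSum, inr_mem_disjSum, Sum.elim_inl, Sum.elim_inr, Prod.exists, mem_product,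
    mem_singleton, mem_univ, and_true]
  refine or_congr Iff.rfl ⟨?_, fun hv => ?_⟩
  · rintro ⟨e', j, rfl, rfl⟩
    exact hψS (e', j)
  · exact ⟨e, (S e).equivFinOfCardEq (hS1 e) ⟨v, hv⟩, rfl, by simp [hψ]⟩

end RGraph

/-! ### The spectral radius and the number of edges -/

namespace RGraph

theorem sum_prod_le_card_rpow_mul {V : Type*} {p : ℝ} (hp : 1 < p) (E : Finset (Finset V))
    {x : V → ℝ} (hx : ∀ v, 0 ≤ x v) :
    ∑ e ∈ E, ∏ v ∈ e, x v ≤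
      (#E : ℝ) ^ (1 - 1 / p) * (∑ e ∈ E, ∏ v ∈ e, x v ^ p) ^ (1 / p) := by
  have hpq := (Real.HolderConjugate.conjExponent hp).symm
  have h := Real.inner_le_Lp_mul_Lq_of_nonneg E hpq (f := fun _ => 1)
    (g := fun e => ∏ v ∈ e, x v) (fun _ _ => zero_le_one) (fun e _ => prod_nonneg fun v _ => hx v)
  have h1 : 1 / p.conjExponent = 1 - 1 / p := by
    have := hpq.inv_add_inv_eq_one
    simp only [one_div]
    linarith
  simp only [one_mul, Real.one_rpow, sum_const, nsmul_eq_mul, mul_one] at h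
  rw [h1] at h
  simpa only [Real.finsetProd_rpow _ _ (fun v _ => hx v)] using h

theorem sum_prod_le_cliqueWeight {r : ℕ} {V : Type*} [Fintype V] [DecidableEq V] {G : SimpleGraph V}
    [DecidableRel G.Adj] {E : Finset (Finset V)} (hE : E ⊆ G.cliqueFinset r)
    {y : V → ℝ} (hy : ∀ v, 0 ≤ y v) : ∑ e ∈ E, ∏ v ∈ e, y v ≤ G.cliqueWeight y r :=
  sum_le_sum_of_subset_of_nonneg hE fun _ _ _ => prod_nonneg fun v _ => hy v

/-- If the edges in `E` are cliques of a `K_{k+1}`-free graph, Hölder's inequality and the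
Lagrangian bound control their share of the spectral radius; the remaining edges are bounded
by their number alone. -/
theorem spectralRadius_le {r k : ℕ} {V : Type*} [Fintype V] [DecidableEq V] [Nonempty V] {p : ℝ}
    (hp : 1 < p) (hk : 0 < k) (hrk : r ≤ k) (hrV : r ≤ Fintype.card V) (H : RGraph r V)
    {G : SimpleGraph V} [DecidableRel G.Adj] (hG : G.CliqueFree (k + 1))
    {E : Finset (Finset V)} (hE : E ⊆ H.edges) (hEG : E ⊆ G.cliqueFinset r) :
    H.spectralRadius p ≤ r.factorial * ((#E : ℝ) ^ (1 - 1 / p) *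
      ((k.choose r : ℝ) / (k : ℝ) ^ r) ^ (1 / p) + (#(H.edges \ E) : ℝ) ^ (1 - 1 / p)) := by
  have hp0 : 0 < p := by linarith
  obtain ⟨x, hx, hxmax⟩ := (isGreatest_spectralRadius hp.le H).1
  rw [hxmax]
  set y : V → ℝ := fun v => |x v| ^ p with hy
  have hy0 : ∀ v, 0 ≤ y v := fun v => by positivity
  have hsum : ∑ v, y v = 1 := by
    have hx' : (∑ v, y v) ^ (1 / p) = 1 := hx
    rwa [one_div, Real.rpow_inv_eq (sum_nonneg fun v _ => hy0 v) zero_le_one hp0.ne',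
      Real.one_rpow] at hx'
  have hq : 0 ≤ 1 - 1 / p := by
    rw [sub_nonneg, div_le_one hp0]
    exact hp.le
  have h1 : ∑ e ∈ E, ∏ v ∈ e, y v ≤ (k.choose r : ℝ) / (k : ℝ) ^ r := by
    have := SimpleGraph.cliqueWeight_le hk hrk hG hy0
    rw [hsum, one_pow, mul_one] at this
    exact (sum_prod_le_cliqueWeight hEG hy0).trans this
  have h2 : ∑ e ∈ H.edges \ E, ∏ v ∈ e, y v ≤ 1 := by
    have hV : 0 < Fintype.card V := Fintype.card_pos
    have := SimpleGraph.cliqueWeight_le (G := (⊤ : SimpleGraph V)) hV hrV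
      (SimpleGraph.cliqueFree_of_card_lt (Nat.lt_succ_self _)) hy0
    rw [hsum, one_pow, mul_one] at this
    refine (sum_prod_le_cliqueWeight (G := ⊤) ?_ hy0).trans (this.trans ?_)
    · intro e he
      rw [SimpleGraph.mem_cliqueFinset_iff]
      exact ⟨fun _ _ _ _ h => h, H.sized (mem_sdiff.mp he).1⟩
    · rw [div_le_one (by positivity)]
      exact_mod_cast Nat.choose_le_pow _ _
  rw [form]
  refine mul_le_mul_of_nonneg_left ?_ (by positivity)
  calc ∑ e ∈ H.edges, ∏ v ∈ e, x v
      ≤ ∑ e ∈ H.edges, ∏ v ∈ e, |x v| := by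
        refine sum_le_sum fun e _ => ?_
        rw [← abs_prod]
        exact le_abs_self _
    _ = ∑ e ∈ E, ∏ v ∈ e, |x v| + ∑ e ∈ H.edges \ E, ∏ v ∈ e, |x v| := by
        rw [add_comm, sum_sdiff hE]
    _ ≤ (#E : ℝ) ^ (1 - 1 / p) * ((k.choose r : ℝ) / (k : ℝ) ^ r) ^ (1 / p) +
          (#(H.edges \ E) : ℝ) ^ (1 - 1 / p) * 1 ^ (1 / p) := by
        refine add_le_add ?_ ?_
        · refine (sum_prod_le_card_rpow_mul hp E fun v => abs_nonneg (x v)).trans ?_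
          gcongr
        · refine (sum_prod_le_card_rpow_mul hp (H.edges \ E) fun v => abs_nonneg (x v)).trans ?_
          gcongr
    _ = _ := by rw [Real.one_rpow, mul_one]

/-- A spectral radius close to that of the Turán `r`-graph forces almost as many edges, all of
them cliques of a `K_{k+1}`-free graph. -/
theorem exists_le_card_of_lt_spectralRadius {p : ℝ} (hp : 1 < p) {k r : ℕ} (hr : 0 < r)
    (hrk : r ≤ k) (M : ℕ) {η : ℝ} (hη : 0 < η) (hη1 : η < 1) :
    ∃ δ : ℝ, 0 < δ ∧ ∃ n₀ : ℕ, ∀ n : ℕ, n₀ < n → ∀ H : RGraph r (Fin n),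
      ∀ (G : SimpleGraph (Fin n)) [DecidableRel G.Adj], G.CliqueFree (k + 1) →
      ∀ E : Finset (Finset (Fin n)), E ⊆ H.edges → E ⊆ G.cliqueFinset r →
      #(H.edges \ E) ≤ M * n ^ (r - 1) →
      (1 - δ) * ((k.descFactorial r : ℝ) / (k : ℝ) ^ r) * (n : ℝ) ^ ((r : ℝ) * (1 - 1 / p))
        < H.spectralRadius p →
      (1 - η) * ((k.choose r : ℝ) / (k : ℝ) ^ r) * (n : ℝ) ^ r ≤ #E := by
  have hp0 : 0 < p := by linarith
  have hk : 0 < k := hr.trans_le hrk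
  set q : ℝ := 1 - 1 / p with hqdef
  have hq : 0 < q := by
    rw [hqdef, sub_pos, div_lt_one hp0]
    exact hp
  set κ : ℝ := (k.choose r : ℝ) / (k : ℝ) ^ r with hκdef
  have hκ : 0 < κ := by
    have := Nat.choose_pos hrk
    positivity
  have hηq : (1 - η) ^ q < 1 := Real.rpow_lt_one (by linarith) (by linarith) hq
  set δ : ℝ := (1 - (1 - η) ^ q) / 2 with hδdef
  have hδ : 0 < δ := by linarith
  have hlim : Filter.Tendsto (fun n : ℕ => ((M : ℝ) / n) ^ q) Filter.atTop (nhds 0) := by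
    have h1 : Filter.Tendsto (fun n : ℕ => (M : ℝ) / n) Filter.atTop (nhds 0) :=
      tendsto_const_div_atTop_nhds_zero_nat _
    have := h1.rpow_const (p := q) (Or.inr hq.le)
    rwa [Real.zero_rpow hq.ne'] at this
  obtain ⟨n₁, hn₁⟩ := Filter.eventually_atTop.mp (hlim.eventually_lt_const (mul_pos hδ hκ))
  refine ⟨δ, hδ, max n₁ r, fun n hn H G _ hG E hE hEG hM hrad => ?_⟩
  have hnr : r ≤ n := (le_max_right _ _).trans hn.le
  have hn0 : 0 < n := hr.trans_le hnr
  have hsmall := hn₁ n ((le_max_left _ _).trans hn.le)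
  have : Nonempty (Fin n) := ⟨⟨0, hn0⟩⟩
  by_contra! hlt
  have hub := spectralRadius_le hp hk hrk (by simpa using hnr) H hG hE hEG
  have hlb := hrad.trans_le hub
  rw [Nat.descFactorial_eq_factorial_mul_choose] at hlb
  push_cast at hlb
  have hn : (0 : ℝ) < n := by exact_mod_cast hn0
  set N : ℝ := (n : ℝ) ^ ((r : ℝ) * q) with hN
  have hNpos : 0 < N := by positivity
  have hpow : ((n : ℝ) ^ r) ^ q = N := by rw [hN, Real.rpow_mul hn.le, Real.rpow_natCast]
  have hκq : κ ^ q * κ ^ (1 / p) = κ := by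
    rw [← Real.rpow_add hκ, hqdef, sub_add_cancel, Real.rpow_one]
  have e1 : (#E : ℝ) ^ q * κ ^ (1 / p) ≤ (1 - η) ^ q * κ * N := by
    calc (#E : ℝ) ^ q * κ ^ (1 / p) ≤ ((1 - η) * κ * (n : ℝ) ^ r) ^ q * κ ^ (1 / p) := by gcongr
      _ = (1 - η) ^ q * (κ ^ q * κ ^ (1 / p)) * N := by
          have : 0 ≤ 1 - η := by linarith
          rw [Real.mul_rpow (by positivity) (by positivity), Real.mul_rpow this hκ.le, hpow]
          ring
      _ = _ := by rw [hκq]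
  have e2 : (#(H.edges \ E) : ℝ) ^ q ≤ δ * κ * N := by
    calc (#(H.edges \ E) : ℝ) ^ q ≤ ((M : ℝ) / n * (n : ℝ) ^ r) ^ q := by
          have : (#(H.edges \ E) : ℝ) ≤ (M : ℝ) * (n : ℝ) ^ (r - 1) := by exact_mod_cast hM
          have h' : (M : ℝ) / n * (n : ℝ) ^ r = M * (n : ℝ) ^ (r - 1) := by
            obtain ⟨m, rfl⟩ := Nat.exists_eq_succ_of_ne_zero hr.ne'
            rw [Nat.succ_sub_one, pow_succ]
            field_simp
          rw [h']
          gcongr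
      _ = ((M : ℝ) / n) ^ q * N := by
          rw [Real.mul_rpow (by positivity) (by positivity), hpow]
      _ ≤ _ := by gcongr
  have e3 : (r.factorial : ℝ) * ((1 - δ) * κ * N) <
      r.factorial * ((1 - η) ^ q * κ * N + δ * κ * N) := by
    calc (r.factorial : ℝ) * ((1 - δ) * κ * N)
        = (1 - δ) * (r.factorial * k.choose r / (k : ℝ) ^ r) * N := by rw [hκdef]; ring
      _ < _ := hlb
      _ ≤ _ := by gcongr
  have e4 := lt_of_mul_lt_mul_left e3 (by positivity)
  have e5 : (1 - η) ^ q = 1 - 2 * δ := by rw [hδdef]; ring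
  rw [e5] at e4
  linarith

end RGraph

/-! ### Stability for the number of `r`-cliques -/

namespace SimpleGraph

variable {V : Type*} [Fintype V] [DecidableEq V] {G : SimpleGraph V} [DecidableRel G.Adj]

theorem cliqueWeight_one (s : ℕ) : G.cliqueWeight (fun _ => 1) s = #(G.cliqueFinset s) := by
  simp [cliqueWeight]

theorem two_mul_card_cliqueFinset_two_le :
    2 * #(G.cliqueFinset 2) ≤ #{x : V × V | G.Adj x.1 x.2} := by
  have hcard : ∀ A ∈ G.cliqueFinset 2, #A.offDiag = 2 := by
    intro A hA
    rw [offDiag_card, ((mem_cliqueFinset_iff).mp hA).2]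
  calc 2 * #(G.cliqueFinset 2) = ∑ A ∈ G.cliqueFinset 2, #A.offDiag := by
        rw [sum_congr rfl hcard, sum_const, smul_eq_mul, mul_comm]
    _ = #((G.cliqueFinset 2).biUnion offDiag) := by
        refine (card_biUnion ?_).symm
        intro A hA B hB hAB
        rw [Function.onFun, Finset.disjoint_left]
        rintro ⟨u, v⟩ hu hv
        rw [mem_offDiag] at hu hv
        have key : ∀ C ∈ G.cliqueFinset 2, u ∈ C → v ∈ C → ({u, v} : Finset V) = C := by
          intro C hC huC hvC
          refine eq_of_subset_of_card_le (insert_subset huC (singleton_subset_iff.mpr hvC)) ?_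
          rw [((mem_cliqueFinset_iff).mp hC).2, card_pair hu.2.2]
        exact hAB ((key A hA hu.1 hu.2.1).symm.trans (key B hB hv.1 hv.2.1))
    _ ≤ _ := by
        refine card_le_card fun x hx => ?_
        obtain ⟨A, hA, hxA⟩ := mem_biUnion.mp hx
        rw [mem_offDiag] at hxA
        simp only [mem_filter, mem_univ, true_and]
        exact ((mem_cliqueFinset_iff).mp hA).1 hxA.1 hxA.2.1 hxA.2.2

/-- Stability for cliques: a `K_{k+1}`-free graph with nearly as many `r`-cliques as possible has
a nearly equitable `k`-colouring with few monochromatic edges. -/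
theorem exists_coloring_of_le_card_cliqueFinset {k r : ℕ} (hr : 2 ≤ r) (hrk : r ≤ k)
    [Nonempty V] (hG : G.CliqueFree (k + 1)) {η : ℝ} (hη : 0 ≤ η)
    (h : (1 - η) * ((k.choose r : ℝ) / (k : ℝ) ^ r) * (Fintype.card V : ℝ) ^ r ≤
      #(G.cliqueFinset r)) :
    ∃ c : V → Fin k,
      (#{x : V × V | G.Adj x.1 x.2 ∧ c x.1 = c x.2} : ℝ) ≤ η * (Fintype.card V : ℝ) ^ 2 ∧
      ∀ i, (#{v | c v = i} : ℝ) - (Fintype.card V : ℝ) / k ≤ √η * Fintype.card V := by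
  set n : ℝ := (Fintype.card V : ℝ) with hn
  have hn0 : 0 < n := by rw [hn]; exact_mod_cast Fintype.card_pos
  have hk : 0 < k := by omega
  have hk0 : (0 : ℝ) < k := by exact_mod_cast hk
  -- Pass from `r`-cliques to edges.
  have hN2 : (1 - η) * ((k.choose 2 : ℝ) / (k : ℝ) ^ 2) * n ^ 2 ≤ #(G.cliqueFinset 2) := by
    have h1 := cliqueWeight_add_le hk hG (y := fun _ => 1) (fun _ => zero_le_one) 2 (r - 2)
      (by omega)
    rw [show 2 + (r - 2) = r by omega] at h1
    simp only [cliqueWeight_one, sum_const, card_univ, nsmul_eq_mul, mul_one] at h1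
    rw [← hn] at h1
    set κ : ℝ := (k.choose r : ℝ) / (k : ℝ) ^ r with hκdef
    have hκ : 0 < κ := by
      have := Nat.choose_pos hrk
      positivity
    refine le_of_mul_le_mul_left ?_ (show 0 < κ * n ^ (r - 2) by positivity)
    calc κ * n ^ (r - 2) * ((1 - η) * ((k.choose 2 : ℝ) / (k : ℝ) ^ 2) * n ^ 2)
        = (k.choose 2 : ℝ) / (k : ℝ) ^ 2 * ((1 - η) * κ * (n ^ (r - 2) * n ^ 2)) := by ring
      _ = (k.choose 2 : ℝ) / (k : ℝ) ^ 2 * ((1 - η) * κ * n ^ r) := by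
          rw [← pow_add, show r - 2 + 2 = r by omega]
      _ ≤ (k.choose 2 : ℝ) / (k : ℝ) ^ 2 * #(G.cliqueFinset r) := by gcongr
      _ ≤ _ := h1
  have hch : (k.choose 2 : ℝ) / (k : ℝ) ^ 2 = (1 - 1 / k) / 2 := by
    rw [Nat.cast_choose_two]
    field_simp
  rw [hch] at hN2
  obtain ⟨c₀, hc₀, hcount⟩ := exists_coloring_card_add_card_le (G := G) k univ fun S _ => hG S
  set c : V → Fin k := fun v => ⟨c₀ v, hc₀ v (mem_univ v)⟩ with hc
  have hcc : ∀ u v, c₀ u = c₀ v ↔ c u = c v := fun u v => by simp [hc]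
  simp only [hcc, univ_product_univ, card_univ] at hcount
  have hadj := two_mul_card_cliqueFinset_two_le (G := G)
  set a : Fin k → ℝ := fun i => #{v | c v = i} with ha
  have hsum : ∑ i, a i = n := by
    have := card_eq_sum_card_fiberwise (f := c) (s := univ) (t := univ) (by simp)
    rw [card_univ] at this
    rw [hn, this, ha]
    push_cast
    rfl
  have hmono : (#{x : V × V | c x.1 = c x.2} : ℝ) = ∑ i, a i ^ 2 := by
    have : #{x : V × V | c x.1 = c x.2} = ∑ i, #{v | c v = i} ^ 2 := by
      rw [card_eq_sum_card_fiberwise (f := fun x => c x.1) (t := univ) (by simp)]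
      refine sum_congr rfl fun i _ => ?_
      rw [sq, ← card_product]
      congr 1
      ext x
      simp only [mem_filter, mem_univ, true_and, mem_product]
      constructor
      · rintro ⟨h1, h2⟩
        exact ⟨h2, h1 ▸ h2⟩
      · rintro ⟨h1, h2⟩
        exact ⟨h1.trans h2.symm, h1⟩
    rw [this, ha]
    push_cast
    rfl
  have hvar : ∑ i, (a i - n / k) ^ 2 = ∑ i, a i ^ 2 - n ^ 2 / k := by
    have : ∀ i, (a i - n / k) ^ 2 = a i ^ 2 - 2 * (n / k) * a i + (n / k) ^ 2 := fun i => by ring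
    simp only [this, sum_add_distrib, sum_sub_distrib, ← mul_sum, hsum, sum_const, card_univ,
      Fintype.card_fin, nsmul_eq_mul]
    field_simp
    ring
  have hcount' : (#{x : V × V | G.Adj x.1 x.2} : ℝ) +
      #{x : V × V | G.Adj x.1 x.2 ∧ c x.1 = c x.2} + ∑ i, a i ^ 2 ≤ n ^ 2 := by
    rw [← hmono, hn]
    exact_mod_cast hcount
  have hadj' : 2 * (#(G.cliqueFinset 2) : ℝ) ≤ #{x : V × V | G.Adj x.1 x.2} := by
    exact_mod_cast hadj
  have htotal : (#{x : V × V | G.Adj x.1 x.2 ∧ c x.1 = c x.2} : ℝ) + ∑ i, (a i - n / k) ^ 2 ≤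
      η * n ^ 2 := by
    have e1 : (1 - η) * ((1 - 1 / k) / 2) * n ^ 2 =
        (n ^ 2 - n ^ 2 / k - η * n ^ 2 + η * (n ^ 2 / k)) / 2 := by ring
    have e2 : 0 ≤ η * (n ^ 2 / k) := by positivity
    rw [e1] at hN2
    linarith
  refine ⟨c, ?_, fun i => ?_⟩
  · have : 0 ≤ ∑ i, (a i - n / k) ^ 2 := sum_nonneg fun i _ => sq_nonneg _
    linarith
  · have h1 : (a i - n / k) ^ 2 ≤ η * n ^ 2 := by
      have h2 := single_le_sum (f := fun i => (a i - n / k) ^ 2) (fun i _ => sq_nonneg _)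
        (mem_univ i)
      have h3 : (0 : ℝ) ≤ #{x : V × V | G.Adj x.1 x.2 ∧ c x.1 = c x.2} := Nat.cast_nonneg _
      linarith
    calc a i - n / k ≤ √((a i - n / k) ^ 2) := by
          rw [Real.sqrt_sq_eq_abs]
          exact le_abs_self _
      _ ≤ √(η * n ^ 2) := Real.sqrt_le_sqrt h1
      _ = √η * n := by rw [Real.sqrt_mul hη, Real.sqrt_sq hn0.le]

end SimpleGraph

/-! ### Distance to the Turán `r`-graph -/

namespace RGraph

/-- The complete `k`-partite `r`-graph has at most the density of the balanced one. -/
theorem card_edges_completePartite_le {r k : ℕ} (hk : 0 < k) (hrk : r ≤ k) {V : Type*} [Fintype V]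
    (c : V → Fin k) :
    (#(completePartite r c).edges : ℝ) ≤
      (k.choose r : ℝ) / (k : ℝ) ^ r * (Fintype.card V : ℝ) ^ r := by
  classical
  set G : SimpleGraph V := (⊤ : SimpleGraph (Fin k)).comap c with hG
  have hfree : G.CliqueFree (k + 1) :=
    SimpleGraph.Colorable.cliqueFree (n := k) ⟨⟨c, fun h => h⟩⟩ (Nat.lt_succ_self k)
  have h := SimpleGraph.cliqueWeight_le hk hrk hfree (y := fun _ => 1) fun _ => zero_le_one
  rw [SimpleGraph.cliqueWeight_one] at h
  simp only [sum_const, card_univ, nsmul_eq_mul, mul_one] at h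
  refine le_trans ?_ h
  refine Nat.cast_le.mpr (card_le_card fun e he => ?_)
  have he' : #e = r ∧ Set.InjOn c (e : Set V) := by simpa [completePartite] using he
  rw [SimpleGraph.mem_cliqueFinset_iff]
  refine ⟨fun u hu v hv huv h => huv (he'.2 hu hv h), he'.1⟩

/-- The edges not kept in the complete partite `r`-graph of a recolouring `c'` of `c`: they are
deleted edges (outside `E`), or contain a recoloured vertex, or a monochromatic edge of `G`. -/
theorem card_sdiff_completePartite_le {r k : ℕ} {V : Type*} [Fintype V] [DecidableEq V]
    (H : RGraph r V) {G : SimpleGraph V} [DecidableRel G.Adj] {E : Finset (Finset V)}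
    (hEG : E ⊆ G.cliqueFinset r) (c c' : V → Fin k) :
    #(H.edges \ (completePartite r c').edges) ≤ #(H.edges \ E) +
      #{v | c' v ≠ c v} * Fintype.card V ^ (r - 1) +
      #{x : V × V | G.Adj x.1 x.2 ∧ c x.1 = c x.2} * Fintype.card V ^ (r - 2) := by
  have hsub : H.edges \ (completePartite r c').edges ⊆ (H.edges \ E) ∪
      (({v | c' v ≠ c v} : Finset V).biUnion fun v => {e ∈ H.edges | {v} ⊆ e}) ∪
      (({x : V × V | G.Adj x.1 x.2 ∧ c x.1 = c x.2} : Finset (V × V)).biUnion fun x =>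
        {e ∈ H.edges | {x.1, x.2} ⊆ e}) := by
    intro e he
    rw [mem_sdiff] at he
    by_contra hcon
    simp only [mem_union, mem_sdiff, mem_biUnion, mem_filter, mem_univ, true_and, not_or,
      not_and, not_exists, not_not, singleton_subset_iff] at hcon
    obtain ⟨⟨h1, h2⟩, h3⟩ := hcon
    have heE := h1 he.1
    have hcc : ∀ v ∈ e, c' v = c v := by
      intro v hv
      by_contra hne
      exact h2 v hne he.1 hv
    have hcl := (SimpleGraph.mem_cliqueFinset_iff.mp (hEG heE)).1
    refine he.2 ?_
    have : #e = r ∧ Set.InjOn c' (e : Set V) := by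
      refine ⟨H.sized he.1, fun u hu v hv huv => ?_⟩
      by_contra hne
      rw [hcc u hu, hcc v hv] at huv
      exact h3 (u, v) ⟨hcl hu hv hne, huv⟩ he.1
        (insert_subset hu (singleton_subset_iff.mpr hv))
    simpa [completePartite] using this
  refine (card_le_card hsub).trans ((card_union_le _ _).trans (add_le_add
    ((card_union_le _ _).trans (add_le_add le_rfl ?_)) ?_))
  · refine card_biUnion_le_card_mul _ _ _ fun v _ => ?_
    simpa using card_filter_superset_le H {v}
  · refine card_biUnion_le_card_mul _ _ _ fun x hx => ?_
    have hne : x.1 ≠ x.2 := (mem_filter.mp hx).2.1.ne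
    simpa [card_pair hne] using card_filter_superset_le H {x.1, x.2}

/-- The edges of `H` that contain a pair of small codegree are few. -/
theorem card_sdiff_filter_isClique_codegreeGraph_le {r : ℕ} {V : Type*} [Fintype V]
    [DecidableEq V] (H : RGraph r V) (m : ℕ) [DecidableRel (H.codegreeGraph m).Adj] :
    #(H.edges \ {e ∈ H.edges | e ∈ (H.codegreeGraph m).cliqueFinset r}) ≤
      Fintype.card V ^ 2 * m := by
  have hsub : H.edges \ {e ∈ H.edges | e ∈ (H.codegreeGraph m).cliqueFinset r} ⊆
      ({x : V × V | #{e ∈ H.edges | {x.1, x.2} ⊆ e} ≤ m} : Finset (V × V)).biUnion fun x =>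
        {e ∈ H.edges | {x.1, x.2} ⊆ e} := by
    intro e he
    simp only [mem_sdiff, mem_filter, not_and] at he
    have hncl := he.2 he.1
    rw [SimpleGraph.mem_cliqueFinset_iff, SimpleGraph.isNClique_iff, not_and'] at hncl
    have hncl := hncl (H.sized he.1)
    simp only [SimpleGraph.IsClique, Set.Pairwise, not_forall] at hncl
    obtain ⟨u, hu, v, hv, huv, hnadj⟩ := hncl
    have hle : #{e ∈ H.edges | {u, v} ⊆ e} ≤ m := not_lt.mp fun h => hnadj ⟨huv, h⟩
    simp only [mem_biUnion, mem_filter, mem_univ, true_and]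
    exact ⟨(u, v), hle, he.1, insert_subset hu (singleton_subset_iff.mpr hv)⟩
  calc _ ≤ _ := card_le_card hsub
    _ ≤ #{x : V × V | #{e ∈ H.edges | {x.1, x.2} ⊆ e} ≤ m} * m :=
        card_biUnion_le_card_mul _ _ _ fun x hx => (mem_filter.mp hx).2
    _ ≤ _ := by
        refine Nat.mul_le_mul_right m ((card_le_univ _).trans ?_)
        rw [Fintype.card_prod, sq]

theorem _root_.Nat.pow_div_le_choose {n r : ℕ} (h : 2 * r ≤ n) :
    (n : ℝ) ^ r / (2 ^ r * r.factorial) ≤ n.choose r := by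
  refine le_trans ?_ (Nat.pow_le_choose r n)
  rw [← div_div, ← div_pow]
  gcongr
  rw [div_le_iff₀ two_pos]
  exact_mod_cast (show n ≤ (n + 1 - r) * 2 by omega)

/-- The combinatorial stability statement: an `r`-graph most of whose edges are cliques of a
`K_{k+1}`-free graph, in nearly the largest possible number, is close to the Turán `r`-graph. -/
theorem closeToTuran_of_le_card {k r n M : ℕ} (hr : 2 ≤ r) (hk : r ≤ k) (hn : 0 < n)
    (H : RGraph r (Fin n)) {G : SimpleGraph (Fin n)} [DecidableRel G.Adj]
    (hGfree : G.CliqueFree (k + 1)) {E : Finset (Finset (Fin n))} (hEH : E ⊆ H.edges)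
    (hEG : E ⊆ G.cliqueFinset r) (hdel : #(H.edges \ E) ≤ M * n ^ (r - 1)) {s : ℝ} (hspos : 0 < s)
    (hE : (1 - s ^ 2) * ((k.choose r : ℝ) / (k : ℝ) ^ r) * (n : ℝ) ^ r ≤ #E) :
    H.CloseToTuran k ((3 * s ^ 2 + 2 * k * s) * (n : ℝ) ^ r +
      2 * (M + k) * (n : ℝ) ^ (r - 1)) := by
  have hk0 : 0 < k := by omega
  have hk0' : (0 : ℝ) < k := by exact_mod_cast hk0
  have : Nonempty (Fin n) := ⟨⟨0, hn⟩⟩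
  obtain ⟨c, hc1, hc2⟩ := SimpleGraph.exists_coloring_of_le_card_cliqueFinset (r := r) hr hk
    hGfree (sq_nonneg s) (by
      rw [Fintype.card_fin]
      exact hE.trans (Nat.cast_le.mpr (card_le_card hEG)))
  rw [Real.sqrt_sq hspos.le] at hc2
  simp only [Fintype.card_fin] at hc1 hc2
  obtain ⟨c', hbal, hdiff⟩ := exists_equitable_recoloring hk0 c
  refine ⟨completePartite r c', ⟨c', hbal, rfl⟩, ?_⟩
  set T := completePartite r c' with hT
  have hD : (#{v | c' v ≠ c v} : ℝ) ≤ k * (s * n + 1) := by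
    calc (#{v | c' v ≠ c v} : ℝ) ≤ ((∑ i, (#{v | c v = i} - n / k) : ℕ) : ℝ) :=
          Nat.cast_le.mpr hdiff
      _ ≤ ∑ i : Fin k, (s * n + 1) := by
          push_cast
          refine sum_le_sum fun i _ => ?_
          have hfloor : (n : ℝ) / k < (n / k : ℕ) + 1 := by
            rw [div_lt_iff₀ hk0']
            have h1 := Nat.div_add_mod n k
            have h2 := Nat.mod_lt n hk0
            exact_mod_cast (show n < (n / k + 1) * k by nlinarith)
          have := hc2 i
          rcases le_total (n / k) #{v | c v = i} with h | h
          · rw [Nat.cast_sub h]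
            linarith
          · rw [Nat.sub_eq_zero_of_le h, Nat.cast_zero]
            positivity
      _ = _ := by
          rw [sum_const, card_univ, Fintype.card_fin, nsmul_eq_mul]
  set κ : ℝ := (k.choose r : ℝ) / (k : ℝ) ^ r with hκ
  have hκ1 : κ ≤ 1 := by
    rw [hκ, div_le_one (by positivity)]
    exact_mod_cast Nat.choose_le_pow _ _
  have hTcard : (#T.edges : ℝ) ≤ κ * (n : ℝ) ^ r := by
    simpa using card_edges_completePartite_le hk0 hk c'
  set P : ℝ := (n : ℝ) ^ (r - 1) with hP
  have hPpos : 0 < P := by positivity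
  have hPn : (n : ℝ) ^ r = n * P := by
    rw [hP, ← pow_succ', show r - 1 + 1 = r by omega]
  have hPn2 : (n : ℝ) ^ 2 * (n : ℝ) ^ (r - 2) = n * P := by
    rw [← hPn, ← pow_add, show 2 + (r - 2) = r by omega]
  have hdel' : (#(H.edges \ E) : ℝ) ≤ M * P := by
    rw [hP]
    exact_mod_cast hdel
  have hsd : (#(H.edges \ T.edges) : ℝ) ≤ M * P + k * (s * n + 1) * P + s ^ 2 * (n * P) := by
    have h := card_sdiff_completePartite_le H hEG c c'
    rw [Fintype.card_fin] at h
    calc (#(H.edges \ T.edges) : ℝ) ≤ #(H.edges \ E) + #{v | c' v ≠ c v} * (n : ℝ) ^ (r - 1) +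
          #{x : Fin n × Fin n | G.Adj x.1 x.2 ∧ c x.1 = c x.2} * (n : ℝ) ^ (r - 2) := by
          exact_mod_cast h
      _ ≤ M * P + k * (s * n + 1) * P + s ^ 2 * (n : ℝ) ^ 2 * (n : ℝ) ^ (r - 2) := by
          gcongr
      _ = _ := by rw [mul_assoc (s ^ 2), hPn2]
  have hsymm : (#(symmDiff H.edges T.edges) : ℝ) =
      #T.edges - #H.edges + 2 * #(H.edges \ T.edges) := by
    have h1 : #(symmDiff H.edges T.edges) = #(H.edges \ T.edges) + #(T.edges \ H.edges) := by
      rw [symmDiff_def, sup_eq_union, card_union_of_disjoint disjoint_sdiff_sdiff]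
    have h2 : #(H.edges \ T.edges) + #T.edges = #(T.edges \ H.edges) + #H.edges := by
      rw [card_sdiff_add_card, card_sdiff_add_card, union_comm]
    have h2' : (#(H.edges \ T.edges) : ℝ) + #T.edges = #(T.edges \ H.edges) + #H.edges := by
      exact_mod_cast h2
    rw [h1]
    push_cast
    linarith
  have hHcard : (1 - s ^ 2) * κ * (n * P) ≤ #H.edges := by
    rw [← hPn]
    exact hE.trans (Nat.cast_le.mpr (card_le_card hEH))
  rw [hPn] at hTcard ⊢
  calc (#(symmDiff H.edges T.edges) : ℝ)
      ≤ κ * (n * P) - (1 - s ^ 2) * κ * (n * P) +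
          2 * (M * P + k * (s * n + 1) * P + s ^ 2 * (n * P)) := by rw [hsymm]; linarith
    _ = (s ^ 2 * κ + 2 * s ^ 2 + 2 * k * s) * (n * P) + 2 * (M + k) * P := by ring
    _ ≤ (s ^ 2 * 1 + 2 * s ^ 2 + 2 * k * s) * (n * P) + 2 * (M + k) * P := by gcongr
    _ = _ := by ring

theorem CloseToTuran.mono {r k : ℕ} {V : Type*} [Fintype V] [DecidableEq V] {H : RGraph r V}
    {m m' : ℝ} (h : H.CloseToTuran k m) (hm : m ≤ m') : H.CloseToTuran k m' := by
  obtain ⟨T, hT, hcard⟩ := h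
  exact ⟨T, hT, hcard.trans hm⟩

end RGraph

theorem theorem3p1 (p : ℝ) (hp : 1 < p) (k r : ℕ) (hr : 3 ≤ r) (hk : r ≤ k)
    (ε : ℝ) (hε : 0 < ε) :
    ∃ δ : ℝ, 0 < δ ∧ ∃ n₀ : ℕ, ∀ n : ℕ, n₀ < n → ∀ H : RGraph r (Fin n),
      H.Free (expandedClique (k + 1) r (le_of_lt hr)) →
      (1 - δ) * ((k.descFactorial r : ℝ) / (k : ℝ) ^ r) * (n : ℝ) ^ ((r : ℝ) * (1 - 1 / p))
        < H.spectralRadius p →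
      H.CloseToTuran k (ε * (n.choose r : ℝ)) := by
  classical
  -- `ε₀ n ^ r` is a lower bound for `ε * n.choose r`; the edges to be changed will number at
  -- most `(3 s ^ 2 + 2 k s) n ^ r + O(n ^ (r - 1))`.
  set ε₀ : ℝ := ε / (2 ^ r * r.factorial) with hε₀
  have hε₀pos : 0 < ε₀ := by positivity
  set s : ℝ := min (1 / 2) (ε₀ / (2 * (3 + 2 * k))) with hs
  have hspos : 0 < s := lt_min (by norm_num) (by positivity)
  have hs1 : s ≤ 1 / 2 := min_le_left _ _
  have hs2 : (3 + 2 * k) * s ≤ ε₀ / 2 := by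
    have : s ≤ ε₀ / (2 * (3 + 2 * k)) := min_le_right _ _
    rw [le_div_iff₀ (by positivity)] at this
    linarith
  set M : ℕ := Fintype.card (ExpandedCliqueVertex (k + 1) r) with hM
  obtain ⟨δ, hδ, n₁, hn₁⟩ := RGraph.exists_le_card_of_lt_spectralRadius hp (by omega) hk M
    (η := s ^ 2) (by positivity) (by nlinarith)
  obtain ⟨n₂, hn₂⟩ := exists_nat_ge (2 * ((M : ℝ) + k) / (ε₀ / 2))
  refine ⟨δ, hδ, max n₁ (max n₂ (2 * r)), fun n hn H hfree hrad => ?_⟩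
  have hn1 : n₁ < n := (le_max_left _ _).trans_lt hn
  have hn2 : n₂ < n := ((le_max_left _ _).trans (le_max_right _ _)).trans_lt hn
  have hn3 : 2 * r < n := ((le_max_right _ _).trans (le_max_right _ _)).trans_lt hn
  have hn0 : 0 < n := by omega
  have hnpos : (0 : ℝ) < n := by exact_mod_cast hn0
  set m : ℕ := M * n ^ (r - 3) with hm
  set G := H.codegreeGraph m with hG
  have hGfree : G.CliqueFree (k + 1) := by
    have := RGraph.cliqueFree_codegreeGraph (le_of_lt hr) hfree
    rwa [Fintype.card_fin] at this
  set E : Finset (Finset (Fin n)) := {e ∈ H.edges | e ∈ G.cliqueFinset r}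
  have hEH : E ⊆ H.edges := filter_subset _ _
  have hEG : E ⊆ G.cliqueFinset r := fun e he => (mem_filter.mp he).2
  have hdel : #(H.edges \ E) ≤ M * n ^ (r - 1) := by
    refine (RGraph.card_sdiff_filter_isClique_codegreeGraph_le H m).trans (le_of_eq ?_)
    rw [Fintype.card_fin, hm, show r - 1 = 2 + (r - 3) by omega, pow_add]
    ring
  have hEcard := hn₁ n hn1 H G hGfree E hEH hEG hdel hrad
  refine (RGraph.closeToTuran_of_le_card (by omega) hk hn0 H hGfree hEH hEG hdel hspos
    hEcard).mono ?_
  have hPn : (n : ℝ) ^ r = n * (n : ℝ) ^ (r - 1) := by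
    rw [← pow_succ', show r - 1 + 1 = r by omega]
  have hlarge : 2 * ((M : ℝ) + k) ≤ ε₀ / 2 * n := by
    rw [div_le_iff₀ (by positivity)] at hn₂
    have : (n₂ : ℝ) ≤ n := by exact_mod_cast hn2.le
    nlinarith
  have hss : 3 * s ^ 2 + 2 * k * s ≤ ε₀ / 2 := by nlinarith
  calc (3 * s ^ 2 + 2 * k * s) * (n : ℝ) ^ r + 2 * (M + k) * (n : ℝ) ^ (r - 1)
      ≤ ε₀ / 2 * (n : ℝ) ^ r + ε₀ / 2 * n * (n : ℝ) ^ (r - 1) := by gcongr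
    _ = ε * ((n : ℝ) ^ r / (2 ^ r * r.factorial)) := by rw [hε₀, hPn]; ring
    _ ≤ _ := by
        gcongr
        exact Nat.pow_div_le_choose hn3.le
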